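/- Let $N\ge 3$, $\alpha\in(0,N)$, $1<p<\frac{N+\alpha}{N-2}$, $2^*=\frac{2N}{N-2}$, $q=2\,\frac{2p+\alpha}{2+\alpha}$ and $r\in[q,2^*)$. Let $I_{\alpha/2}(x)=A_{\alpha/2}|x|^{-(N-\alpha/2)}$ with $A_{\beta}=\frac{\Gamma((N-\beta)/2)}{\Gamma(\beta/2)\,\pi^{N/2}\,2^{\beta}}$ be the Riesz potential of order $\alpha/2$ on $\mathbb{R}^N$, and let $E_R=E_R^{\alpha,p}(\mathbb{R}^N)$ be the space of radial, measurable, weakly differentiable functions $u:\mathbb{R}^N\to\mathbb{R}$ (identified when equal almost everywhere) with $\nabla u\in L^2$ and $\int |I_{\alpha/2}\star|u|^p|^2<\infty$. For $u\in E_R$ put $$I(u)=\frac12\int|\nabla u|^2+\frac1{2p}\int|I_{\alpha/2}\star|u|^p|^2,\qquad F(u)=\frac1r\int|u|^r,\qquad G(u)=\frac1{2^*}\int|u|^{2^*},$$ and for $u\in E_R\setminus\{0\}$, $c\in\mathbb{R}$ put $\lambda_c(u)=\frac{I(u)-G(u)-c}{F(u)}$. Let $\sigma=\frac{2+\alpha}{2(p-1)}$,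 $s_\ell=\sigma\ell-N$, $u_t(x)=t^\sigma u(tx)$, $\varphi_{c,u}(t)=\lambda_c(u_t)$ for $t>0$, and $$\mathcal N_c=\{u_t:\ u\in E_R\setminus\{0\},\ t>0,\ \varphi_{c,u}'(t)=0\},\qquad \Lambda_c=\lambda_c|_{\mathcal N_c}.$$ Let $S$ be the largest constant such that $S\left(\int|u|^{2^*}\right)^{2/2^*}\le\int|\nabla u|^2$ for all $u\in E_R$, and let $$c^*=\frac12\,\frac{s_{2^*}-s_q}{s_{2^*}}\left(\frac{2^*}{2}\,\frac{s_q}{s_{2^*}}\right)^{\frac{s_q}{s_{2^*}-s_q}}S^{\frac{s_{2^*}}{s_{2^*}-s_q}}.$$ If $c>c^*$, then $$\inf_{u\in\mathcal N_c}\Lambda_c(u)<0,$$ where the infimum is taken in $[-\infty,\infty]$. In particular, the infimum is not attained at any $u\in\mathcal N_c$ with $\Lambda_c(u)>0$. -/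

import Mathlib

open MeasureTheory
open scoped ENNReal ContDiff

noncomputable section

namespace SPS

/-- Euclidean space `ℝ^N`. -/
abbrev Sp (N : ℕ) : Type := EuclideanSpace ℝ (Fin N)

/-- The critical Sobolev exponent `2* = 2N/(N-2)`. -/
def critExp (N : ℕ) : ℝ := 2 * (N : ℝ) / ((N : ℝ) - 2)

/-- The exponent `q = 2(2p+α)/(2+α)`. -/
def qExp (α p : ℝ) : ℝ := 2 * ((2 * p + α) / (2 + α))

/-- The scaling exponent `σ = (2+α)/(2(p-1))`. -/
def sig (α p : ℝ) : ℝ := (2 + α) / (2 * (p - 1))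

/-- `s_ℓ = σ ℓ - N`. -/
def sExp (N : ℕ) (α p l : ℝ) : ℝ := sig α p * l - (N : ℝ)

/-- The normalisation constant `A_β` of the Riesz potential of order `β`. -/
def rieszConst (N : ℕ) (β : ℝ) : ℝ :=
  Real.Gamma (((N : ℝ) - β) / 2) /
    (Real.Gamma (β / 2) * Real.pi ^ ((N : ℝ) / 2) * (2 : ℝ) ^ β)

/-- The Riesz kernel `I_β(x) = A_β / |x|^(N-β)`. -/
def rieszKernel (N : ℕ) (β : ℝ) (x : Sp N) : ℝ :=
  rieszConst N β / ‖x‖ ^ ((N : ℝ) - β)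

/-- The convolution `(I_β ⋆ |u|^p)(x)`, with values in `[0, ∞]`. -/
def rieszConv (N : ℕ) (β p : ℝ) (u : Sp N → ℝ) (x : Sp N) : ℝ≥0∞ :=
  ∫⁻ y, ENNReal.ofReal (rieszKernel N β (x - y)) * ENNReal.ofReal (|u y| ^ p)

/-- `∫ |I_{α/2} ⋆ |u|^p|^2`, with values in `[0, ∞]`. -/
def coulomb (N : ℕ) (α p : ℝ) (u : Sp N → ℝ) : ℝ≥0∞ :=
  ∫⁻ x, (rieszConv N (α / 2) p u x) ^ 2

/-- `g` is a weak gradient of `u` on `ℝ^N`: both are locally integrable and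
`∫ u ∂_v φ = - ∫ ⟨g, v⟩ φ` for every test function `φ` and every direction `v`. -/
def HasWeakGrad {N : ℕ} (u : Sp N → ℝ) (g : Sp N → Sp N) : Prop :=
  LocallyIntegrable u volume ∧ LocallyIntegrable g volume ∧
    ∀ φ : Sp N → ℝ, ContDiff ℝ ∞ φ → HasCompactSupport φ → ∀ v : Sp N,
      ∫ x, u x * fderiv ℝ φ x v = -∫ x, inner ℝ (g x) v * φ x

open Classical in
/-- The weak gradient of `u` (unique up to a null set when it exists; `0` otherwise). -/
def weakGrad {N : ℕ} (u : Sp N → ℝ) : Sp N → Sp N :=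
  if h : ∃ g, HasWeakGrad u g then h.choose else 0

/-- The Coulomb-Sobolev space `E^{α,p}(ℝ^N)`: measurable functions with finite Coulomb norm
that are weakly differentiable with gradient in `L²`. -/
def CoulombSobolev (N : ℕ) (α p : ℝ) : Set (Sp N → ℝ) :=
  {u | AEMeasurable u volume ∧ coulomb N α p u < ⊤ ∧
    ∃ g : Sp N → Sp N, HasWeakGrad u g ∧ MemLp g 2 volume}

/-- Radial functions, as classes modulo null sets: `u` is invariant under the orthogonal group. -/
def IsRadial {N : ℕ} (u : Sp N → ℝ) : Prop :=
  ∀ A : Sp N ≃ₗᵢ[ℝ] Sp N, (fun x => u (A x)) =ᵐ[volume] u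

/-- The radial subspace `E_R^{α,p}(ℝ^N)`. -/
def RadialSpace (N : ℕ) (α p : ℝ) : Set (Sp N → ℝ) :=
  {u | u ∈ CoulombSobolev N α p ∧ IsRadial u}

/-- `E_R^{α,p}(ℝ^N) \ {0}`; functions are identified when they agree almost everywhere. -/
def RadialSpaceNZ (N : ℕ) (α p : ℝ) : Set (Sp N → ℝ) :=
  {u | u ∈ RadialSpace N α p ∧ ¬ u =ᵐ[volume] 0}

/-- `∫ |∇u|^2`. -/
def dirichlet {N : ℕ} (u : Sp N → ℝ) : ℝ := ∫ x, ‖weakGrad u x‖ ^ 2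

/-- `I(u) = 1/2 ∫ |∇u|^2 + 1/(2p) ∫ |I_{α/2} ⋆ |u|^p|^2`. -/
def funI (N : ℕ) (α p : ℝ) (u : Sp N → ℝ) : ℝ :=
  1 / 2 * dirichlet u + 1 / (2 * p) * (coulomb N α p u).toReal

/-- `(1/ℓ) ∫ |u|^ℓ`. -/
def funPow {N : ℕ} (l : ℝ) (u : Sp N → ℝ) : ℝ := 1 / l * ∫ x, |u x| ^ l

/-- `F(u) = (1/r) ∫ |u|^r`. -/
def funF {N : ℕ} (r : ℝ) (u : Sp N → ℝ) : ℝ := funPow r u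

/-- `G(u) = (1/2*) ∫ |u|^{2*}`. -/
def funG (N : ℕ) (u : Sp N → ℝ) : ℝ := funPow (critExp N) u

/-- `λ_c(u) = (I(u) - G(u) - c) / F(u)`. -/
def lam (N : ℕ) (α p r c : ℝ) (u : Sp N → ℝ) : ℝ :=
  (funI N α p u - funG N u - c) / funF r u

/-- The scaling `u_t(x) = t^σ u(tx)`. -/
def scale {N : ℕ} (α p : ℝ) (u : Sp N → ℝ) (t : ℝ) : Sp N → ℝ :=
  fun x => t ^ sig α p * u (t • x)

/-- The fibering map `φ_{c,u}(t) = λ_c(u_t)`. -/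
def fiber (N : ℕ) (α p r c : ℝ) (u : Sp N → ℝ) (t : ℝ) : ℝ :=
  lam N α p r c (scale α p u t)

/-- The scaled Nehari manifold
`N_c = {u_t : u ∈ E_R \ {0}, t > 0, φ_{c,u}'(t) = 0}`. -/
def nehari (N : ℕ) (α p r c : ℝ) : Set (Sp N → ℝ) :=
  {w | ∃ u ∈ RadialSpaceNZ N α p, ∃ t : ℝ, 0 < t ∧
    HasDerivAt (fiber N α p r c u) 0 t ∧ w = scale α p u t}

/-- The best Sobolev constant: the largest `S` with `S ‖u‖_{2*}^2 ≤ ‖∇u‖_2^2` on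
`E_R^{α,p}(ℝ^N)`. -/
def sobolevConst (N : ℕ) (α p : ℝ) : ℝ :=
  sSup {S : ℝ | ∀ u ∈ RadialSpace N α p,
    S * (∫ x, |u x| ^ critExp N) ^ (2 / critExp N) ≤ dirichlet u}

/-- The critical energy level `c*`. -/
def cStar (N : ℕ) (α p : ℝ) : ℝ :=
  let sq := sExp N α p (qExp α p)
  let sc := sExp N α p (critExp N)
  1 / 2 * ((sc - sq) / sc) * (critExp N / 2 * (sq / sc)) ^ (sq / (sc - sq)) *
    sobolevConst N α p ^ (sc / (sc - sq))

/-- `inf_{u ∈ N_c} Λ_c(u)`, as an extended real number, where `Λ_c` is `λ_c` restricted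
to `N_c`. -/
def infLam (N : ℕ) (α p r c : ℝ) : EReal :=
  ⨅ u ∈ nehari N α p r c, ((lam N α p r c u : ℝ) : EReal)

end SPS

end

/-!
The proof rests on the fibering formula (`fiber_eq`): along `u_t` the map `φ_{c,u}` equals
`(t ^ s_q I(u) - t ^ s_{2*} G(u) - c) / (t ^ s_r F(u))`. For `c > 0` and `s_q ≤ s_r < s_{2*}` it
always has a critical point (`exists_hasDerivAt_zero`), so every `u` contributes to `N_c`, and
`Λ_c` is negative there as soon as `t ^ s_q I(u) - t ^ s_{2*} G(u) < c` for all `t > 0`.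

Since `s_{2*} = (2*/2) s_q`, the level `c*` is the classical `S ^ (N/2) / N` (`cStar_eq`), and
Young's inequality with exponents `2*/2` and `N/2` gives
`t ^ s_q I(u) - t ^ s_{2*} G(u) ≤ S' ^ (N/2) / N` whenever `2 I(u) ≤ S' (∫ |u| ^ 2*) ^ (2/2*)`
(`mul_sub_rpow_mul_le`). It remains to find, for each `S' > S`, a nonzero `u ∈ E_R` with this
property. By definition of `S` some `u ∈ E_R` has Sobolev quotient below `S'`; multiplying it by a
small constant keeps the quotient and makes the Coulomb term, of degree `2p > 2`, negligible
(`exists_funI_le`).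

Two points need care. The integral `∫ |u| ^ r` must converge and be positive: instead of the
embedding `E_R ⊂ L^q`, the near-optimal function is first multiplied by a smooth radial cutoff at
a large radius, which changes the Sobolev quotient arbitrarily little
(`exists_quotient_lt_integrable`), and for functions of bounded support `L^{2*} ⊂ L^r`. And `S` is
a supremum of reals, so the set of admissible constants must be bounded above: this holds because
`E_R` contains a nonzero bump function (`cutoff_mem_radialSpace`), whose Coulomb energy is finite
by `coulomb_lt_top_of_bounded`.
-/

namespace SPS

variable {N : ℕ}

/-! ### Weak gradients -/

/-- The fundamental lemma of the calculus of variations for vector fields. -/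
theorem ae_eq_zero_of_weak_zero {h : Sp N → Sp N} (hh : LocallyIntegrable h volume)
    (h0 : ∀ φ : Sp N → ℝ, ContDiff ℝ ∞ φ → HasCompactSupport φ → ∀ v : Sp N,
      ∫ x, inner ℝ (h x) v * φ x = 0) : h =ᵐ[volume] 0 := by
  refine ae_eq_zero_of_integral_contDiff_smul_eq_zero hh fun φ hφ hc => ?_
  have hint : Integrable (fun x => φ x • h x) volume :=
    hh.integrable_smul_left_of_hasCompactSupport hφ.continuous hc
  refine ext_inner_left ℝ fun v => ?_
  rw [inner_zero_right, ← integral_inner (𝕜 := ℝ) hint v, ← h0 φ hφ hc v]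
  refine integral_congr_ae (Filter.Eventually.of_forall fun x => ?_)
  change inner ℝ v (φ x • h x) = inner ℝ (h x) v * φ x
  rw [real_inner_smul_right, real_inner_comm]
  ring

theorem HasWeakGrad.integrable_inner_mul {u : Sp N → ℝ} {g : Sp N → Sp N} (hg : HasWeakGrad u g)
    {φ : Sp N → ℝ} (hφ : Continuous φ) (hc : HasCompactSupport φ) (v : Sp N) :
    Integrable (fun x => inner ℝ (g x) v * φ x) volume := by
  have := (hg.2.1.integrable_smul_left_of_hasCompactSupport hφ hc).inner_const (𝕜 := ℝ) v
  refine this.congr (Filter.Eventually.of_forall fun x => ?_)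
  simp only [real_inner_smul_left]
  ring

/-- A weak gradient is unique up to a null set. -/
theorem HasWeakGrad.unique {u : Sp N → ℝ} {g h : Sp N → Sp N} (hg : HasWeakGrad u g)
    (hh : HasWeakGrad u h) : g =ᵐ[volume] h := by
  have := ae_eq_zero_of_weak_zero (hg.2.1.sub hh.2.1) fun φ hφ hc v => ?_
  · filter_upwards [this] with x hx
    exact sub_eq_zero.1 hx
  · have e : ∀ x, inner ℝ ((g - h) x) v * φ x = inner ℝ (g x) v * φ x - inner ℝ (h x) v * φ x := by
      intro x
      rw [Pi.sub_apply, inner_sub_left, sub_mul]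
    simp only [e]
    rw [integral_sub (hg.integrable_inner_mul hφ.continuous hc v)
      (hh.integrable_inner_mul hφ.continuous hc v)]
    have h1 := hg.2.2 φ hφ hc v
    have h2 := hh.2.2 φ hφ hc v
    linarith

/-- Any weak gradient computes the Dirichlet energy, which is defined through a chosen one. -/
theorem HasWeakGrad.dirichlet_eq {u : Sp N → ℝ} {g : Sp N → Sp N} (hg : HasWeakGrad u g) :
    dirichlet u = ∫ x, ‖g x‖ ^ 2 := by
  have hex : ∃ g, HasWeakGrad u g := ⟨g, hg⟩
  have hw : HasWeakGrad u (weakGrad u) := by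
    rw [weakGrad, dif_pos hex]
    exact hex.choose_spec
  refine integral_congr_ae ?_
  filter_upwards [hw.unique hg] with x hx
  rw [hx]

theorem dirichlet_nonneg (u : Sp N → ℝ) : 0 ≤ dirichlet u :=
  integral_nonneg fun _ => by positivity

theorem HasWeakGrad.const_mul {u : Sp N → ℝ} {g : Sp N → Sp N} (hg : HasWeakGrad u g) (a : ℝ) :
    HasWeakGrad (fun x => a * u x) (fun x => a • g x) := by
  refine ⟨hg.1.smul a, hg.2.1.smul a, fun φ hφ hc v => ?_⟩
  have := hg.2.2 φ hφ hc v
  simp only [real_inner_smul_left, mul_assoc]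
  rw [integral_const_mul, integral_const_mul, this]
  ring

theorem locallyIntegrable_comp_smul {E : Type*} [NormedAddCommGroup E]
    {f : Sp N → E} (hf : LocallyIntegrable f volume) {t : ℝ} (ht : t ≠ 0) :
    LocallyIntegrable (fun x => f (t • x)) volume := by
  rw [locallyIntegrable_iff]
  intro k hk
  have hk' : IsCompact ((fun x : Sp N => t • x) '' k) := hk.image (continuous_const_smul t)
  have h1 := (hf.integrableOn_isCompact hk').integrable_indicator hk'.measurableSet
  have h2 := h1.comp_smul ht
  rw [← integrable_indicator_iff hk.measurableSet]
  refine h2.congr (Filter.Eventually.of_forall fun x => ?_)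
  by_cases hx : x ∈ k
  · have : t • x ∈ (fun x : Sp N => t • x) '' k := ⟨x, hx, rfl⟩
    simp only [Set.indicator_of_mem hx, Set.indicator_of_mem this]
  · have : t • x ∉ (fun x : Sp N => t • x) '' k := by
      rintro ⟨y, hy, hxy⟩
      exact hx (smul_right_injective _ ht hxy ▸ hy)
    simp only [Set.indicator_of_notMem hx, Set.indicator_of_notMem this]

theorem HasWeakGrad.comp_smul {u : Sp N → ℝ} {g : Sp N → Sp N} (hg : HasWeakGrad u g)
    {t : ℝ} (ht : 0 < t) :
    HasWeakGrad (fun x => u (t • x)) (fun x => t • g (t • x)) := by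
  refine ⟨locallyIntegrable_comp_smul hg.1 ht.ne',
    (locallyIntegrable_comp_smul hg.2.1 ht.ne').smul t, fun φ hφ hc v => ?_⟩
  have hψ : ContDiff ℝ ∞ (fun x : Sp N => φ (t⁻¹ • x)) := hφ.comp (contDiff_const_smul _)
  have hψc : HasCompactSupport (fun x : Sp N => φ (t⁻¹ • x)) := hc.comp_smul (inv_ne_zero ht.ne')
  have key := hg.2.2 _ hψ hψc v
  have hd : ∀ x : Sp N, fderiv ℝ (fun x : Sp N => φ (t⁻¹ • x)) x v
      = t⁻¹ * fderiv ℝ φ (t⁻¹ • x) v := by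
    intro x
    have := fderiv_comp_smul (𝕜 := ℝ) (f := φ) (x := x) (c := t⁻¹)
    rw [this]
    simp
  simp only [hd] at key
  have h1 := Measure.integral_comp_smul (volume : Measure (Sp N))
    (fun x => u x * (t⁻¹ * fderiv ℝ φ (t⁻¹ • x) v)) t
  have h2 := Measure.integral_comp_smul (volume : Measure (Sp N))
    (fun x => inner ℝ (g x) v * φ (t⁻¹ • x)) t
  simp only [inv_smul_smul₀ ht.ne', key] at h1 h2
  have h3 : ∫ x, u (t • x) * fderiv ℝ φ x v
      = t * ∫ x, u (t • x) * (t⁻¹ * fderiv ℝ φ x v) := by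
    rw [← integral_const_mul]
    congr 1
    ext x
    field_simp
  have h4 : ∫ x, inner ℝ (t • g (t • x)) v * φ x
      = t * ∫ x, inner ℝ (g (t • x)) v * φ x := by
    rw [← integral_const_mul]
    congr 1
    ext x
    rw [real_inner_smul_left]
    ring
  rw [h3, h4, h1, h2]
  simp only [smul_eq_mul]
  ring

/-- Leibniz rule for a weakly differentiable function and a smooth one. -/
theorem HasWeakGrad.smooth_mul {u : Sp N → ℝ} {g : Sp N → Sp N} (hg : HasWeakGrad u g)
    {χ : Sp N → ℝ} (hχ : ContDiff ℝ ∞ χ) :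
    HasWeakGrad (fun x => χ x * u x) (fun x => χ x • g x + u x • gradient χ x) := by
  have hgrad : Continuous (gradient χ) := by
    have : Continuous (fderiv ℝ χ) := hχ.continuous_fderiv (by simp)
    exact (InnerProductSpace.toDual ℝ (Sp N)).symm.continuous.comp this
  refine ⟨hg.1.continuous_smul hχ.continuous,
    (hg.2.1.continuous_smul hχ.continuous).add (hg.1.smul_continuous hgrad), fun φ hφ hc v => ?_⟩
  have key := hg.2.2 _ (hχ.mul hφ) (hc.mul_left (f' := φ) (f := χ)) v
  have hd : ∀ x, fderiv ℝ (fun x => χ x * φ x) x v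
      = χ x * fderiv ℝ φ x v + φ x * fderiv ℝ χ x v := by
    intro x
    have h1 : DifferentiableAt ℝ χ x := (hχ.differentiable (by simp)) x
    have h2 : DifferentiableAt ℝ φ x := (hφ.differentiable (by simp)) x
    rw [fderiv_fun_mul h1 h2]
    simp
  have cχ' : Continuous fun x => fderiv ℝ χ x v :=
    (hχ.continuous_fderiv (by simp)).clm_apply continuous_const
  have cφ' : Continuous fun x => fderiv ℝ φ x v :=
    (hφ.continuous_fderiv (by simp)).clm_apply continuous_const
  have sφ' : HasCompactSupport fun x => fderiv ℝ φ x v := hc.fderiv_apply ℝ v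
  have i1 : Integrable (fun x => u x * (χ x * fderiv ℝ φ x v)) volume :=
    hg.1.integrable_smul_right_of_hasCompactSupport (hχ.continuous.mul cφ')
      (sφ'.mul_left (f := χ))
  have i2 : Integrable (fun x => u x * (φ x * fderiv ℝ χ x v)) volume :=
    hg.1.integrable_smul_right_of_hasCompactSupport (hφ.continuous.mul cχ') hc.mul_right
  have i3 : Integrable (fun x => inner ℝ (g x) v * (χ x * φ x)) volume :=
    hg.integrable_inner_mul (hχ.continuous.mul hφ.continuous) (hc.mul_left (f := χ)) v
  have e1 : ∫ x, u x * fderiv ℝ (fun x => χ x * φ x) x v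
      = (∫ x, u x * (χ x * fderiv ℝ φ x v)) + ∫ x, u x * (φ x * fderiv ℝ χ x v) := by
    rw [← integral_add i1 i2]
    congr 1
    ext x
    rw [hd]
    ring
  have e2 : ∫ x, inner ℝ (χ x • g x + u x • gradient χ x) v * φ x
      = (∫ x, inner ℝ (g x) v * (χ x * φ x)) + ∫ x, u x * (φ x * fderiv ℝ χ x v) := by
    rw [← integral_add i3 i2]
    congr 1
    ext x
    rw [inner_add_left, real_inner_smul_left, real_inner_smul_left, inner_gradient_left]
    ring
  have e3 : ∫ x, χ x * u x * fderiv ℝ φ x v = ∫ x, u x * (χ x * fderiv ℝ φ x v) := by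
    congr 1
    ext x
    ring
  rw [e3, e2]
  have : ∫ x, u x * fderiv ℝ (fun x => χ x * φ x) x v = -∫ x, inner ℝ (g x) v * (χ x * φ x) := key
  rw [e1] at this
  linarith

theorem hasWeakGrad_one : HasWeakGrad (fun _ : Sp N => (1 : ℝ)) 0 := by
  refine ⟨locallyIntegrable_const 1, locallyIntegrable_zero, fun φ hφ hc v => ?_⟩
  have cφ' : Continuous fun x => fderiv ℝ φ x v :=
    (hφ.continuous_fderiv (by simp)).clm_apply continuous_const
  have i1 : Integrable φ volume := hφ.continuous.integrable_of_hasCompactSupport hc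
  have i2 : Integrable (fun x => fderiv ℝ φ x v) volume :=
    cφ'.integrable_of_hasCompactSupport (hc.fderiv_apply ℝ v)
  have := integral_mul_fderiv_eq_neg_fderiv_mul_of_integrable (μ := (volume : Measure (Sp N)))
    (f := fun _ : Sp N => (1 : ℝ)) (g := φ) (v := v)
    (by simp) (by simpa using i2) (by simpa using i1) (by fun_prop)
    (fun x _ => hφ.differentiable (by simp) x)
  rw [this]
  simp

/-! ### The Coulomb energy -/

theorem lintegral_comp_smul_pos (f : Sp N → ℝ≥0∞) {t : ℝ} (ht : 0 < t) :
    ∫⁻ x, f (t • x) = ENNReal.ofReal (t ^ (-(N : ℝ))) * ∫⁻ x, f x := by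
  have he : MeasurableEmbedding (fun x : Sp N => t • x) :=
    (Homeomorph.smulOfNeZero t ht.ne').measurableEmbedding
  rw [← he.lintegral_map, Measure.map_addHaar_smul _ ht.ne', lintegral_smul_measure]
  congr 2
  rw [finrank_euclideanSpace_fin, abs_of_nonneg (by positivity), Real.rpow_neg ht.le,
    Real.rpow_natCast]

theorem rieszKernel_nonneg {β : ℝ} (hβ0 : 0 < β) (hβN : β < N) (x : Sp N) :
    0 ≤ rieszKernel N β x := by
  have h1 : 0 ≤ Real.Gamma (((N : ℝ) - β) / 2) :=
    (Real.Gamma_pos_of_pos (by linarith)).le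
  have h2 : 0 ≤ Real.Gamma (β / 2) := (Real.Gamma_pos_of_pos (by linarith)).le
  unfold rieszKernel rieszConst
  positivity

theorem rieszKernel_smul {β t : ℝ} (ht : 0 < t) (x : Sp N) :
    rieszKernel N β (t • x) = t ^ (β - (N : ℝ)) * rieszKernel N β x := by
  unfold rieszKernel
  rw [norm_smul, Real.norm_of_nonneg ht.le, Real.mul_rpow ht.le (norm_nonneg x),
    show β - (N : ℝ) = -((N : ℝ) - β) by ring, Real.rpow_neg ht.le]
  ring

theorem rieszConv_mono {β p : ℝ} {u w : Sp N → ℝ} (hp : 0 ≤ p) (h : ∀ x, |w x| ≤ |u x|)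
    (x : Sp N) : rieszConv N β p w x ≤ rieszConv N β p u x := by
  unfold rieszConv
  refine lintegral_mono fun y => mul_le_mul_right (ENNReal.ofReal_le_ofReal
    (Real.rpow_le_rpow (abs_nonneg _) (h y) hp)) _

theorem coulomb_mono {α p : ℝ} {u w : Sp N → ℝ} (hp : 0 ≤ p) (h : ∀ x, |w x| ≤ |u x|) :
    coulomb N α p w ≤ coulomb N α p u := by
  unfold coulomb
  gcongr
  exact rieszConv_mono hp h _

theorem rieszConv_const_mul {β p a : ℝ} (ha : 0 < a) (u : Sp N → ℝ) (x : Sp N) :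
    rieszConv N β p (fun y => a * u y) x = ENNReal.ofReal (a ^ p) * rieszConv N β p u x := by
  unfold rieszConv
  rw [← lintegral_const_mul' _ _ ENNReal.ofReal_ne_top]
  congr 1
  ext y
  rw [abs_mul, abs_of_pos ha, Real.mul_rpow ha.le (abs_nonneg _),
    ENNReal.ofReal_mul (by positivity)]
  ring

theorem coulomb_const_mul {α p a : ℝ} (ha : 0 < a) (u : Sp N → ℝ) :
    coulomb N α p (fun y => a * u y) = ENNReal.ofReal (a ^ (2 * p)) * coulomb N α p u := by
  unfold coulomb
  simp only [rieszConv_const_mul ha]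
  rw [← lintegral_const_mul' _ _ ENNReal.ofReal_ne_top]
  congr 1
  ext y
  rw [mul_pow, ← ENNReal.ofReal_pow (by positivity), ← Real.rpow_natCast, ← Real.rpow_mul ha.le]
  congr 3
  push_cast
  ring

theorem rieszConv_comp_smul {β p t : ℝ} (ht : 0 < t) (u : Sp N → ℝ)
    (x : Sp N) :
    rieszConv N β p (fun y => u (t • y)) x
      = ENNReal.ofReal (t ^ (-β)) * rieszConv N β p u (t • x) := by
  have hk : ∀ y : Sp N, rieszKernel N β (x - y)
      = t ^ ((N : ℝ) - β) * rieszKernel N β (t • x - t • y) := by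
    intro y
    rw [← smul_sub, rieszKernel_smul ht, ← mul_assoc, ← Real.rpow_add ht]
    simp
  unfold rieszConv
  simp only [hk]
  rw [lintegral_comp_smul_pos (fun y => ENNReal.ofReal (t ^ ((N : ℝ) - β)
    * rieszKernel N β (t • x - y)) * ENNReal.ofReal (|u y| ^ p)) ht]
  simp only [ENNReal.ofReal_mul (Real.rpow_nonneg ht.le _), mul_assoc]
  rw [lintegral_const_mul' _ _ ENNReal.ofReal_ne_top, ← mul_assoc,
    ← ENNReal.ofReal_mul (by positivity), ← Real.rpow_add ht]
  congr 3
  ring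

theorem coulomb_comp_smul {α p t : ℝ} (ht : 0 < t) (u : Sp N → ℝ) :
    coulomb N α p (fun y => u (t • y))
      = ENNReal.ofReal (t ^ (-α - (N : ℝ))) * coulomb N α p u := by
  unfold coulomb
  simp only [rieszConv_comp_smul ht]
  rw [lintegral_comp_smul_pos (fun x => (ENNReal.ofReal (t ^ (-(α / 2)))
    * rieszConv N (α / 2) p u x) ^ 2) ht]
  simp only [mul_pow]
  rw [lintegral_const_mul' _ _ (by finiteness), ← mul_assoc,
    ← ENNReal.ofReal_pow (by positivity), ← ENNReal.ofReal_mul (by positivity),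
    ← Real.rpow_natCast, ← Real.rpow_mul ht.le, ← Real.rpow_add ht]
  congr 3
  push_cast
  ring

theorem sq_setLIntegral_le {X : Type*} [MeasurableSpace X] {μ : Measure X} {s : Set X}
    {k : X → ℝ≥0∞} (hk : AEMeasurable k (μ.restrict s)) :
    (∫⁻ y in s, k y ∂μ) ^ 2 ≤ μ s * ∫⁻ y in s, k y ^ 2 ∂μ := by
  have h := ENNReal.lintegral_mul_le_Lp_mul_Lq (μ.restrict s) (p := 2) (q := 2)
    (Real.holderConjugate_iff.2 ⟨by norm_num, by norm_num⟩)
    (f := fun _ => 1) (g := k) aemeasurable_const hk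
  simp only [Pi.mul_apply, one_mul, ENNReal.one_rpow, lintegral_const,
    Measure.restrict_apply_univ] at h
  have h2 := pow_le_pow_left' h 2
  refine h2.trans_eq ?_
  rw [mul_pow, ← ENNReal.rpow_natCast, ← ENNReal.rpow_natCast, ← ENNReal.rpow_mul,
    ← ENNReal.rpow_mul]
  norm_num

/-- Young's inequality `‖k ⋆ 1_s‖₂ ≤ ‖1_s‖₁ ‖k‖₂`, squared. -/
theorem lintegral_sq_conv_le_of_sq {s : Set (Sp N)}
    {k : Sp N → ℝ≥0∞} (hk : Measurable k) :
    ∫⁻ x, (∫⁻ y in s, k (x - y)) ^ 2 ≤ volume s ^ 2 * ∫⁻ x, k x ^ 2 := by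
  have hm : Measurable fun z : Sp N × Sp N => k (z.1 - z.2) :=
    hk.comp (measurable_fst.sub measurable_snd)
  calc ∫⁻ x, (∫⁻ y in s, k (x - y)) ^ 2
      ≤ ∫⁻ x, volume s * ∫⁻ y in s, k (x - y) ^ 2 := by
        refine lintegral_mono fun x => sq_setLIntegral_le ?_
        exact (hk.comp (measurable_const.sub measurable_id)).aemeasurable
    _ = volume s * ∫⁻ y in s, ∫⁻ x, k (x - y) ^ 2 := by
        rw [lintegral_const_mul _ (Measurable.lintegral_prod_right (hm.pow_const 2)),
          lintegral_lintegral_swap (hm.pow_const 2).aemeasurable]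
    _ = volume s ^ 2 * ∫⁻ x, k x ^ 2 := by
        have : ∀ y : Sp N, ∫⁻ x, k (x - y) ^ 2 = ∫⁻ x, k x ^ 2 := fun y =>
          lintegral_sub_right_eq_self (fun x => k x ^ 2) y
        simp only [this, lintegral_const, Measure.restrict_apply_univ]
        ring

/-- Young's inequality `‖k ⋆ 1_s‖₂ ≤ ‖1_s‖₂ ‖k‖₁`, squared. -/
theorem lintegral_sq_conv_le_of_one {s : Set (Sp N)}
    {k : Sp N → ℝ≥0∞} (hk : Measurable k) :
    ∫⁻ x, (∫⁻ y in s, k (x - y)) ^ 2 ≤ volume s * (∫⁻ x, k x) ^ 2 := by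
  have hm : Measurable fun z : Sp N × Sp N => k (z.1 - z.2) :=
    hk.comp (measurable_fst.sub measurable_snd)
  have hle : ∀ x : Sp N, ∫⁻ y in s, k (x - y) ≤ ∫⁻ y, k y := fun x =>
    (setLIntegral_le_lintegral s _).trans_eq (lintegral_sub_left_eq_self k x)
  calc ∫⁻ x, (∫⁻ y in s, k (x - y)) ^ 2
      ≤ ∫⁻ x, (∫⁻ y, k y) * ∫⁻ y in s, k (x - y) := by
        refine lintegral_mono fun x => ?_
        rw [sq]
        exact mul_le_mul' (hle x) le_rfl
    _ = (∫⁻ y, k y) * ∫⁻ y in s, ∫⁻ x, k (x - y) := by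
        rw [lintegral_const_mul _ (Measurable.lintegral_prod_right hm),
          lintegral_lintegral_swap hm.aemeasurable]
    _ = volume s * (∫⁻ x, k x) ^ 2 := by
        have : ∀ y : Sp N, ∫⁻ x, k (x - y) = ∫⁻ x, k x := fun y =>
          lintegral_sub_right_eq_self k y
        simp only [this, lintegral_const, Measure.restrict_apply_univ]
        ring

theorem lintegral_rieszKernel_ball_lt_top {β : ℝ} (hN : 1 ≤ N) (hβ0 : 0 < β) (hβN : β < N) :
    ∫⁻ x in Metric.ball (0 : Sp N) 1, ENNReal.ofReal (rieszKernel N β x) < ⊤ := by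
  have h : IntegrableOn (fun x : Sp N => rieszConst N β / ‖x‖ ^ ((N : ℝ) - β))
      (Metric.ball (0 : Sp N) 1) volume := by
    have : Nonempty (Fin N) := ⟨⟨0, hN⟩⟩
    rw [integrableOn_fun_norm_addHaar volume (f := fun y : ℝ => rieszConst N β / y ^ ((N : ℝ) - β)),
      finrank_euclideanSpace_fin]
    have h1 : IntegrableOn (fun y : ℝ => rieszConst N β * y ^ (β - 1)) (Set.Ioo 0 1) := by
      have := (intervalIntegral.intervalIntegrable_rpow' (a := 0) (b := 1) (r := β - 1)
        (by linarith)).const_mul (rieszConst N β)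
      exact (this.1).mono_set Set.Ioo_subset_Ioc_self
    refine h1.congr_fun (fun y hy => ?_) measurableSet_Ioo
    have hy0 : 0 < y := hy.1
    simp only [smul_eq_mul]
    rw [← Real.rpow_natCast, Nat.cast_sub hN, div_eq_mul_inv, ← Real.rpow_neg hy0.le,
      mul_left_comm, ← Real.rpow_add hy0]
    congr 2
    push_cast
    ring
  have h2 := h.hasFiniteIntegral
  rw [hasFiniteIntegral_iff_ofReal] at h2
  · exact h2
  · exact Filter.Eventually.of_forall fun x => rieszKernel_nonneg hβ0 hβN x

theorem lintegral_sq_rieszKernel_compl_ball_lt_top {β : ℝ} (hβ0 : 0 < β) (hβN : 2 * β < N) :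
    ∫⁻ x in (Metric.ball (0 : Sp N) 1)ᶜ, ENNReal.ofReal (rieszKernel N β x) ^ 2 < ⊤ := by
  have hβN' : β < N := by linarith
  have hc : 0 ≤ rieszConst N β := by
    -- The constant is the value of the kernel at a unit vector.
    obtain rfl | h := Nat.eq_zero_or_pos N
    · norm_num at hβN
      linarith
    have := rieszKernel_nonneg hβ0 hβN' (EuclideanSpace.single (⟨0, h⟩ : Fin N) (1 : ℝ))
    simpa [rieszKernel] using this
  set e : ℝ := 2 * ((N : ℝ) - β) with he
  have hint : Integrable (fun x : Sp N => (1 + ‖x‖) ^ (-e)) volume :=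
    integrable_one_add_norm (by rw [finrank_euclideanSpace_fin]; linarith)
  have hint2 := (hint.const_mul (rieszConst N β ^ 2 * 2 ^ e)).lintegral_lt_top
  refine lt_of_le_of_lt ?_ hint2
  refine (setLIntegral_mono' Metric.isOpen_ball.measurableSet.compl fun x hx => ?_).trans
    (setLIntegral_le_lintegral _ _)
  have hx1 : 1 ≤ ‖x‖ := by simpa using hx
  have hx0 : 0 < ‖x‖ := by linarith
  rw [← ENNReal.ofReal_pow (rieszKernel_nonneg hβ0 hβN' x)]
  refine ENNReal.ofReal_le_ofReal ?_
  have h1 : ‖x‖ ^ (-e) ≤ 2 ^ e * (1 + ‖x‖) ^ (-e) := by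
    have h2 : (2 * ‖x‖) ^ (-e) ≤ (1 + ‖x‖) ^ (-e) :=
      Real.rpow_le_rpow_of_nonpos (by linarith) (by linarith) (by linarith)
    rw [Real.mul_rpow (by norm_num) hx0.le, Real.rpow_neg (by norm_num)] at h2
    calc ‖x‖ ^ (-e) = 2 ^ e * ((2 ^ e)⁻¹ * ‖x‖ ^ (-e)) := by
          rw [mul_inv_cancel_left₀]
          positivity
      _ ≤ _ := by gcongr
  calc rieszKernel N β x ^ 2 = rieszConst N β ^ 2 * ‖x‖ ^ (-e) := by
        unfold rieszKernel
        rw [div_pow, ← Real.rpow_natCast (‖x‖ ^ _), ← Real.rpow_mul hx0.le, Real.rpow_neg hx0.le,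
          div_eq_mul_inv]
        congr 3
        push_cast
        ring
    _ ≤ rieszConst N β ^ 2 * (2 ^ e * (1 + ‖x‖) ^ (-e)) := by gcongr
    _ = _ := by ring

theorem measurable_rieszKernel (β : ℝ) : Measurable (rieszKernel N β) := by
  unfold rieszKernel
  fun_prop

/-- Bounded functions with bounded support have finite Coulomb energy. The Riesz kernel of order
`α / 2` is integrable near the origin and, since `α < N`, square integrable away from it. -/
theorem coulomb_lt_top_of_bounded {α p : ℝ} (hN : 1 ≤ N) (hα0 : 0 < α) (hαN : α < N) (hp : 0 < p)
    {u : Sp N → ℝ} {s : Set (Sp N)} (hs : MeasurableSet s) (hsf : volume s ≠ ⊤)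
    (hu1 : ∀ x, |u x| ≤ 1) (hus : ∀ x ∉ s, u x = 0) :
    coulomb N α p u < ⊤ := by
  set B := Metric.ball (0 : Sp N) 1 with hB
  have hBm : MeasurableSet B := Metric.isOpen_ball.measurableSet
  set k : Sp N → ℝ≥0∞ := fun x => ENNReal.ofReal (rieszKernel N (α / 2) x) with hkdef
  have hk : Measurable k := (measurable_rieszKernel _).ennreal_ofReal
  set k1 : Sp N → ℝ≥0∞ := B.indicator k with hk1
  set k2 : Sp N → ℝ≥0∞ := Bᶜ.indicator k with hk2
  have hk1m : Measurable k1 := hk.indicator hBm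
  have hk2m : Measurable k2 := hk.indicator hBm.compl
  have hsum : ∀ x, k x = k1 x + k2 x := fun x => (Set.indicator_self_add_compl_apply B k x).symm
  have hconv : ∀ x, rieszConv N (α / 2) p u x
      ≤ (∫⁻ y in s, k1 (x - y)) + ∫⁻ y in s, k2 (x - y) := by
    intro x
    have hm1 : Measurable fun y => k1 (x - y) := hk1m.comp (measurable_const.sub measurable_id)
    rw [← lintegral_add_left hm1, ← lintegral_indicator hs]
    refine lintegral_mono fun y => ?_
    by_cases hy : y ∈ s
    · rw [Set.indicator_of_mem hy, ← hsum]
      refine mul_le_of_le_one_right' ?_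
      rw [ENNReal.ofReal_le_one]
      exact Real.rpow_le_one (abs_nonneg _) (hu1 y) hp.le
    · simp [hus y hy, Real.zero_rpow hp.ne']
  have hmeas : ∀ k' : Sp N → ℝ≥0∞, Measurable k' →
      Measurable fun x => (2 : ℝ≥0∞) * (∫⁻ y in s, k' (x - y)) ^ 2 := fun k' hk' =>
    (Measurable.lintegral_prod_right (f := fun x y : Sp N => k' (x - y))
      (hk'.comp (measurable_fst.sub measurable_snd))).pow_const 2 |>.const_mul 2
  have hbd : coulomb N α p u ≤ 2 * (volume s * (∫⁻ x, k1 x) ^ 2)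
      + 2 * (volume s ^ 2 * ∫⁻ x, k2 x ^ 2) := by
    calc coulomb N α p u
        ≤ ∫⁻ x, (2 * (∫⁻ y in s, k1 (x - y)) ^ 2 + 2 * (∫⁻ y in s, k2 (x - y)) ^ 2) := by
          refine lintegral_mono fun x => (pow_le_pow_left' (hconv x) 2).trans ?_
          have := ENNReal.rpow_add_le_mul_rpow_add_rpow (∫⁻ y in s, k1 (x - y))
            (∫⁻ y in s, k2 (x - y)) (p := 2) (by norm_num)
          norm_num at this
          rw [← mul_add]
          exact this
      _ = 2 * (∫⁻ x, (∫⁻ y in s, k1 (x - y)) ^ 2) + 2 * ∫⁻ x, (∫⁻ y in s, k2 (x - y)) ^ 2 := by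
          rw [lintegral_add_left (hmeas k1 hk1m), lintegral_const_mul' _ _ (by simp),
            lintegral_const_mul' _ _ (by simp)]
      _ ≤ _ := by
          gcongr
          · exact lintegral_sq_conv_le_of_one hk1m
          · exact lintegral_sq_conv_le_of_sq hk2m
  refine hbd.trans_lt ?_
  have f1 : ∫⁻ x, k1 x ≠ ⊤ := by
    rw [hk1, lintegral_indicator hBm]
    exact (lintegral_rieszKernel_ball_lt_top hN (by linarith) (by linarith)).ne
  have f2 : ∫⁻ x, k2 x ^ 2 ≠ ⊤ := by
    have : ∀ x, k2 x ^ 2 = Bᶜ.indicator (fun x => k x ^ 2) x := by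
      intro x
      by_cases hx : x ∈ Bᶜ
      · simp only [hk2, Set.indicator_of_mem hx]
      · simp only [hk2, Set.indicator_of_notMem hx]
        norm_num
    simp only [this]
    rw [lintegral_indicator hBm.compl]
    exact (lintegral_sq_rieszKernel_compl_ball_lt_top (by linarith) (by linarith)).ne
  finiteness

/-! ### A smooth radial cutoff -/

/-- A smooth radial cutoff, equal to `1` on the unit ball and vanishing where `2 ≤ ‖x‖ ^ 2`. -/
noncomputable def cutoff (x : Sp N) : ℝ := Real.smoothTransition (2 - ‖x‖ ^ 2)

theorem contDiff_cutoff : ContDiff ℝ ∞ (cutoff (N := N)) :=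
  Real.smoothTransition.contDiff.comp (contDiff_const.sub (contDiff_norm_sq ℝ))

theorem cutoff_nonneg (x : Sp N) : 0 ≤ cutoff x := Real.smoothTransition.nonneg _

theorem cutoff_le_one (x : Sp N) : cutoff x ≤ 1 := Real.smoothTransition.le_one _

theorem abs_cutoff_le_one (x : Sp N) : |cutoff x| ≤ 1 := by
  rw [abs_of_nonneg (cutoff_nonneg x)]
  exact cutoff_le_one x

theorem cutoff_eq_one {x : Sp N} (hx : ‖x‖ ≤ 1) : cutoff x = 1 :=
  Real.smoothTransition.one_of_one_le (by nlinarith [norm_nonneg x])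

theorem cutoff_eq_zero {x : Sp N} (hx : 2 ≤ ‖x‖) : cutoff x = 0 :=
  Real.smoothTransition.zero_of_nonpos (by nlinarith [norm_nonneg x])

theorem hasCompactSupport_cutoff : HasCompactSupport (cutoff (N := N)) := by
  refine HasCompactSupport.intro (isCompact_closedBall (0 : Sp N) 2) fun x hx => ?_
  refine cutoff_eq_zero ?_
  rw [Metric.mem_closedBall, dist_zero_right, not_le] at hx
  exact hx.le

theorem cutoff_map (A : Sp N ≃ₗᵢ[ℝ] Sp N) (x : Sp N) : cutoff (A x) = cutoff x := by
  simp [cutoff]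

theorem continuous_gradient {f : Sp N → ℝ} (hf : ContDiff ℝ ∞ f) : Continuous (gradient f) :=
  (InnerProductSpace.toDual ℝ (Sp N)).symm.continuous.comp (hf.continuous_fderiv (by simp))

theorem gradient_comp_smul (f : Sp N → ℝ) (t : ℝ) (x : Sp N) :
    gradient (fun y => f (t • y)) x = t • gradient f (t • x) := by
  refine ext_inner_right ℝ fun v => ?_
  rw [inner_gradient_left, real_inner_smul_left, inner_gradient_left, fderiv_comp_smul]
  simp

theorem gradient_cutoff_eq_zero {x : Sp N} (hx : ‖x‖ < 1) : gradient cutoff x = 0 := by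
  have h : cutoff =ᶠ[nhds x] fun _ : Sp N => (1 : ℝ) := by
    filter_upwards [Metric.isOpen_ball.mem_nhds (mem_ball_zero_iff.2 hx)] with y hy
    exact cutoff_eq_one (mem_ball_zero_iff.1 hy).le
  rw [h.gradient_eq]
  simp

theorem hasCompactSupport_gradient_cutoff : HasCompactSupport (gradient (cutoff (N := N))) :=
  (hasCompactSupport_cutoff.fderiv ℝ).comp_left (map_zero _)

theorem memLp_gradient_cutoff (q : ℝ≥0∞) :
    MemLp (gradient (cutoff (N := N))) q volume :=
  (continuous_gradient contDiff_cutoff).memLp_of_hasCompactSupport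
    hasCompactSupport_gradient_cutoff

/-- The `L^N` norm of a gradient is invariant under dilations. -/
theorem eLpNorm_gradient_comp_smul (hN : N ≠ 0) (f : Sp N → ℝ) {t : ℝ} (ht : 0 < t) :
    eLpNorm (gradient fun y => f (t • y)) (N : ℝ≥0∞) volume
      = eLpNorm (gradient f) (N : ℝ≥0∞) volume := by
  have hN0 : (0 : ℝ) < N := by exact_mod_cast Nat.pos_of_ne_zero hN
  rw [eLpNorm_eq_lintegral_rpow_enorm_toReal (by exact_mod_cast hN) (by simp),
    eLpNorm_eq_lintegral_rpow_enorm_toReal (by exact_mod_cast hN) (by simp)]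
  congr 1
  simp only [gradient_comp_smul, enorm_smul, ENNReal.toReal_natCast]
  rw [lintegral_comp_smul_pos (fun x => (‖t‖ₑ * ‖gradient f x‖ₑ) ^ (N : ℝ)) ht]
  simp only [ENNReal.mul_rpow_of_nonneg _ _ hN0.le]
  rw [lintegral_const_mul' _ _ (by finiteness), ← mul_assoc, Real.enorm_of_nonneg ht.le,
    ENNReal.ofReal_rpow_of_pos ht, ← ENNReal.ofReal_mul (by positivity), ← Real.rpow_add ht]
  simp

theorem HasWeakGrad.dirichlet_eq_eLpNorm {u : Sp N → ℝ} {g : Sp N → Sp N} (hg : HasWeakGrad u g)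
    (hg2 : MemLp g 2 volume) : dirichlet u = (eLpNorm g 2 volume).toReal ^ 2 := by
  have h0 : 0 ≤ ∫ x, ‖g x‖ ^ 2 := integral_nonneg fun _ => by positivity
  rw [hg.dirichlet_eq, hg2.eLpNorm_eq_integral_rpow_norm (by norm_num) (by norm_num)]
  simp only [ENNReal.toReal_ofNat, Real.rpow_ofNat]
  rw [ENNReal.toReal_ofReal (by positivity), ← Real.rpow_natCast, ← Real.rpow_mul h0]
  norm_num

theorem critExp_pos (hN : 3 ≤ N) : 0 < critExp N := by
  have : (3 : ℝ) ≤ N := by exact_mod_cast hN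
  have : (0 : ℝ) < N - 2 := by linarith
  unfold critExp
  positivity

theorem memLp_of_integrable_rpow {u : Sp N → ℝ} {l : ℝ} (hl : 0 < l) (hu : AEMeasurable u volume)
    (hi : Integrable (fun x => |u x| ^ l) volume) : MemLp u (ENNReal.ofReal l) volume := by
  rw [← integrable_norm_rpow_iff hu.aestronglyMeasurable (by simpa using hl) (by simp)]
  simpa [ENNReal.toReal_ofReal hl.le] using hi

theorem integrable_rpow_of_memLp {u : Sp N → ℝ} {l : ℝ} (hl : 0 < l)
    (hi : MemLp u (ENNReal.ofReal l) volume) : Integrable (fun x => |u x| ^ l) volume := by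
  have := hi.integrable_norm_rpow (by simpa using hl) (by simp)
  simpa [ENNReal.toReal_ofReal hl.le] using this

theorem tendsto_eLpNorm_tail {u : Sp N → ℝ} {l : ℝ} (hl : 0 < l)
    (hu : MemLp u (ENNReal.ofReal l) volume) :
    Filter.Tendsto (fun n : ℕ => eLpNorm ({x : Sp N | (n : ℝ) + 1 ≤ ‖x‖}.indicator u)
      (ENNReal.ofReal l) volume) Filter.atTop (nhds 0) := by
  have hl0 : ENNReal.ofReal l ≠ 0 := by simpa using hl
  have hm : ∀ n : ℕ, MeasurableSet {x : Sp N | (n : ℝ) + 1 ≤ ‖x‖} := fun n =>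
    measurableSet_le measurable_const measurable_norm
  simp only [eLpNorm_eq_lintegral_rpow_enorm_toReal hl0 ENNReal.ofReal_ne_top,
    ENNReal.toReal_ofReal hl.le]
  have h1 : Filter.Tendsto (fun n : ℕ => ∫⁻ x, ‖({x : Sp N | (n : ℝ) + 1 ≤ ‖x‖}.indicator u) x‖ₑ ^ l)
      Filter.atTop (nhds (∫⁻ _ : Sp N, 0)) := by
    refine tendsto_lintegral_of_dominated_convergence' (fun x => ‖u x‖ₑ ^ l) (fun n => ?_)
      (fun n => Filter.Eventually.of_forall fun x => ?_) ?_
      (Filter.Eventually.of_forall fun x => ?_)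
    · exact ((hu.1.indicator (hm n)).enorm).pow_const l
    · exact ENNReal.rpow_le_rpow (enorm_indicator_le_enorm_self _ _) hl.le
    · have := lintegral_rpow_enorm_lt_top_of_eLpNorm_lt_top hl0 ENNReal.ofReal_ne_top hu.2
      rw [ENNReal.toReal_ofReal hl.le] at this
      exact this.ne
    · refine tendsto_const_nhds.congr' ?_
      obtain ⟨k, hk⟩ := exists_nat_gt ‖x‖
      filter_upwards [Filter.eventually_ge_atTop k] with n hn
      have hkn : (k : ℝ) ≤ n := by exact_mod_cast hn
      have : x ∉ {x : Sp N | (n : ℝ) + 1 ≤ ‖x‖} := by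
        simp only [Set.mem_ofPred_eq, not_le]
        linarith
      rw [Set.indicator_of_notMem this]
      simp [hl]
  rw [lintegral_zero] at h1
  have h2 := h1.ennrpow_const (1 / l)
  rwa [ENNReal.zero_rpow_of_pos (by positivity)] at h2

/-- The exponents `2*`, `N`, `2` of the Hölder estimate `‖u ∇χ‖₂ ≤ ‖u‖_{2*} ‖∇χ‖_N`. -/
theorem holderTriple_critExp (hN : 3 ≤ N) :
    ENNReal.HolderTriple (ENNReal.ofReal (critExp N)) (N : ℝ≥0∞) 2 := by
  have hN3 : (3 : ℝ) ≤ N := by exact_mod_cast hN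
  have h2 : (0 : ℝ) < N - 2 := by linarith
  have h0 : (0 : ℝ) < N := by linarith
  refine ⟨?_⟩
  rw [← ENNReal.ofReal_natCast N, ← ENNReal.ofReal_inv_of_pos (critExp_pos hN),
    ← ENNReal.ofReal_inv_of_pos h0, ← ENNReal.ofReal_add (inv_nonneg.2 (critExp_pos hN).le)
    (inv_nonneg.2 h0.le), show (2 : ℝ≥0∞) = ENNReal.ofReal 2 by norm_num,
    ← ENNReal.ofReal_inv_of_pos (by norm_num)]
  congr 1
  unfold critExp
  field_simp
  ring

/-! ### Truncation to bounded support -/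

/-- The product of `u` with the cutoff at radius `n + 1`. -/
noncomputable def truncate (u : Sp N → ℝ) (n : ℕ) (x : Sp N) : ℝ := cutoff (((n : ℝ) + 1)⁻¹ • x) * u x

theorem abs_truncate_le (u : Sp N → ℝ) (n : ℕ) (x : Sp N) : |truncate u n x| ≤ |u x| := by
  rw [truncate, abs_mul]
  exact mul_le_of_le_one_left (abs_nonneg _) (abs_cutoff_le_one _)

theorem aemeasurable_truncate {u : Sp N → ℝ} (hu : AEMeasurable u volume) (n : ℕ) :
    AEMeasurable (truncate u n) volume :=
  ((contDiff_cutoff.continuous.comp (continuous_const_smul _)).measurable.aemeasurable).mul hu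

theorem truncate_eventuallyEq (u : Sp N → ℝ) (x : Sp N) :
    ∀ᶠ n : ℕ in Filter.atTop, truncate u n x = u x := by
  obtain ⟨k, hk⟩ := exists_nat_gt ‖x‖
  filter_upwards [Filter.eventually_ge_atTop k] with n hn
  have hkn : (k : ℝ) ≤ n := by exact_mod_cast hn
  have hn0 : (0 : ℝ) < n + 1 := by positivity
  rw [truncate, cutoff_eq_one, one_mul]
  rw [norm_smul, norm_inv, Real.norm_of_nonneg hn0.le, inv_mul_le_one₀ hn0]
  linarith

theorem truncate_eq_zero (u : Sp N → ℝ) (n : ℕ) {x : Sp N}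
    (hx : x ∉ Metric.closedBall (0 : Sp N) (2 * ((n : ℝ) + 1))) : truncate u n x = 0 := by
  have hn0 : (0 : ℝ) < n + 1 := by positivity
  rw [Metric.mem_closedBall, dist_zero_right, not_le] at hx
  rw [truncate, cutoff_eq_zero, zero_mul]
  rw [norm_smul, norm_inv, Real.norm_of_nonneg hn0.le, le_inv_mul_iff₀ hn0]
  linarith

theorem IsRadial.truncate {u : Sp N → ℝ} (hu : IsRadial u) (n : ℕ) : IsRadial (truncate u n) := by
  intro A
  filter_upwards [hu A] with x hx
  simp only [SPS.truncate]
  rw [hx, ← map_smul, cutoff_map]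

theorem tendsto_integral_truncate {u : Sp N → ℝ} (hu : AEMeasurable u volume) {l : ℝ} (hl : 0 < l)
    (hi : Integrable (fun x => |u x| ^ l) volume) :
    Filter.Tendsto (fun n : ℕ => ∫ x, |truncate u n x| ^ l) Filter.atTop
      (nhds (∫ x, |u x| ^ l)) := by
  refine tendsto_integral_of_dominated_convergence (fun x => |u x| ^ l) (fun n => ?_) hi
    (fun n => Filter.Eventually.of_forall fun x => ?_) (Filter.Eventually.of_forall fun x => ?_)
  · have := (aemeasurable_truncate hu n).norm.pow_const l
    exact this.aestronglyMeasurable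
  · rw [Real.norm_of_nonneg (by positivity)]
    exact Real.rpow_le_rpow (abs_nonneg _) (abs_truncate_le u n x) hl.le
  · refine tendsto_const_nhds.congr' ?_
    filter_upwards [truncate_eventuallyEq u x] with n hn
    rw [hn]

/-- Truncation does not increase the Dirichlet energy in the limit: the extra term `u ∇χ` is
controlled by the `L^{2*}` norm of `u` outside a large ball, times the dilation invariant `L^N`
norm of `∇χ`. -/
theorem exists_weakGrad_truncate (hN : 3 ≤ N) {u : Sp N → ℝ} {g : Sp N → Sp N}
    (hg : HasWeakGrad u g) (hg2 : MemLp g 2 volume)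
    (hu : MemLp u (ENNReal.ofReal (critExp N)) volume) :
    (∀ n, ∃ h, HasWeakGrad (truncate u n) h ∧ MemLp h 2 volume) ∧
      ∀ K, dirichlet u < K → ∀ᶠ n in Filter.atTop, dirichlet (truncate u n) < K := by
  set χ : ℕ → Sp N → ℝ := fun n x => cutoff (((n : ℝ) + 1)⁻¹ • x) with hχ
  have hχs : ∀ n, ContDiff ℝ ∞ (χ n) := fun n => contDiff_cutoff.comp (contDiff_const_smul _)
  have hn0 : ∀ n : ℕ, (0 : ℝ) < ((n : ℝ) + 1)⁻¹ := fun n => by positivity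
  have htriple := holderTriple_critExp hN
  set C := eLpNorm (gradient (cutoff (N := N))) (N : ℝ≥0∞) volume with hC
  have hCf : C ≠ ⊤ := (memLp_gradient_cutoff _).2.ne
  have hgrad : ∀ n, eLpNorm (gradient (χ n)) (N : ℝ≥0∞) volume = C := fun n =>
    eLpNorm_gradient_comp_smul (by omega) _ (hn0 n)
  have hgm : ∀ n, MemLp (gradient (χ n)) (N : ℝ≥0∞) volume := fun n =>
    ⟨(continuous_gradient (hχs n)).aestronglyMeasurable, by rw [hgrad]; exact hCf.lt_top⟩
  have m1 : ∀ n, MemLp (fun x => χ n x • g x) 2 volume := by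
    intro n
    refine hg2.mono ((hχs n).continuous.aestronglyMeasurable.smul hg2.1)
      (Filter.Eventually.of_forall fun x => ?_)
    rw [norm_smul]
    exact mul_le_of_le_one_left (norm_nonneg _) (abs_cutoff_le_one _)
  have m2 : ∀ n, MemLp (fun x => u x • gradient (χ n) x) 2 volume := fun n =>
    MemLp.smul (hgm n) hu
  have hw : ∀ n, HasWeakGrad (truncate u n) (fun x => χ n x • g x + u x • gradient (χ n) x) :=
    fun n => hg.smooth_mul (hχs n)
  have m3 : ∀ n, MemLp (fun x => χ n x • g x + u x • gradient (χ n) x) 2 volume :=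
    fun n => (m1 n).add (m2 n)
  refine ⟨fun n => ⟨_, hw n, m3 n⟩, fun K hK => ?_⟩
  have htail : Filter.Tendsto (fun n : ℕ => eLpNorm (fun x => u x • gradient (χ n) x) 2 volume)
      Filter.atTop (nhds 0) := by
    have h1 := ENNReal.Tendsto.mul_const (b := C) (tendsto_eLpNorm_tail (critExp_pos hN) hu)
      (Or.inr hCf)
    rw [zero_mul] at h1
    refine tendsto_of_tendsto_of_tendsto_of_le_of_le tendsto_const_nhds h1 (fun n => zero_le)
      fun n => ?_
    have he : (fun x => u x • gradient (χ n) x)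
        = ({x : Sp N | (n : ℝ) + 1 ≤ ‖x‖}.indicator u) • gradient (χ n) := by
      ext1 x
      rw [Pi.smul_apply']
      by_cases hx : x ∈ {x : Sp N | (n : ℝ) + 1 ≤ ‖x‖}
      · rw [Set.indicator_of_mem hx]
      · have h1 : (0 : ℝ) < n + 1 := by positivity
        have : gradient (χ n) x = 0 := by
          rw [hχ, gradient_comp_smul, gradient_cutoff_eq_zero, smul_zero]
          rw [norm_smul, norm_inv, Real.norm_of_nonneg h1.le, inv_mul_lt_one₀ h1]
          simpa using hx
        rw [this, smul_zero, smul_zero]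
    have hm : MeasurableSet {x : Sp N | (n : ℝ) + 1 ≤ ‖x‖} :=
      measurableSet_le measurable_const measurable_norm
    rw [he]
    beta_reduce
    rw [← hgrad n]
    exact eLpNorm_smul_le_mul_eLpNorm (hgm n).1 (hu.1.indicator hm)
  have htail' := (ENNReal.tendsto_toReal ENNReal.zero_ne_top).comp htail
  have hlim : Filter.Tendsto (fun n : ℕ => ((eLpNorm g 2 volume).toReal
      + (eLpNorm (fun x => u x • gradient (χ n) x) 2 volume).toReal) ^ 2) Filter.atTop
      (nhds (((eLpNorm g 2 volume).toReal + 0) ^ 2)) :=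
    (tendsto_const_nhds.add htail').pow 2
  rw [add_zero, ← hg.dirichlet_eq_eLpNorm hg2] at hlim
  filter_upwards [hlim.eventually_lt_const hK] with n hn
  refine lt_of_le_of_lt ?_ hn
  rw [(hw n).dirichlet_eq_eLpNorm (m3 n)]
  refine pow_le_pow_left₀ ENNReal.toReal_nonneg ?_ 2
  rw [← ENNReal.toReal_add hg2.2.ne (m2 n).2.ne]
  refine ENNReal.toReal_mono (ENNReal.add_ne_top.2 ⟨hg2.2.ne, (m2 n).2.ne⟩) ?_
  refine (eLpNorm_add_le (m1 n).1 (m2 n).1 (by norm_num)).trans ?_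
  refine add_le_add_left (eLpNorm_mono fun x => ?_) _
  rw [norm_smul]
  exact mul_le_of_le_one_left (norm_nonneg _) (abs_cutoff_le_one _)

theorem truncate_mem_radialSpace (hN : 3 ≤ N) {α p : ℝ} (hp : 0 ≤ p) {u : Sp N → ℝ}
    (hu : u ∈ RadialSpace N α p) (hi : MemLp u (ENNReal.ofReal (critExp N)) volume) (n : ℕ) :
    truncate u n ∈ RadialSpace N α p := by
  obtain ⟨⟨hm, hc, g, hg, hg2⟩, hr⟩ := hu
  exact ⟨⟨aemeasurable_truncate hm n, (coulomb_mono hp (abs_truncate_le u n)).trans_lt hc,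
    (exists_weakGrad_truncate hN hg hg2 hi).1 n⟩, hr.truncate n⟩

theorem integrable_truncate_rpow {u : Sp N → ℝ} {l r : ℝ} (hr : 0 < r) (hrl : r ≤ l)
    (hu : MemLp u (ENNReal.ofReal l) volume) (n : ℕ) :
    Integrable (fun x => |truncate u n x| ^ r) volume := by
  refine integrable_rpow_of_memLp hr ?_
  have h1 : MemLp (truncate u n) (ENNReal.ofReal l) volume :=
    hu.mono (aemeasurable_truncate hu.1.aemeasurable n).aestronglyMeasurable
      (Filter.Eventually.of_forall (abs_truncate_le u n))
  exact h1.mono_exponent_of_measure_support_ne_top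
    (s := Metric.closedBall (0 : Sp N) (2 * ((n : ℝ) + 1))) (fun x hx => truncate_eq_zero u n hx)
    measure_closedBall_lt_top.ne (ENNReal.ofReal_le_ofReal hrl)

/-- A function of `E_R` whose Sobolev quotient is below `S` may be replaced by one with bounded
support, for which in addition the integrals of lower powers converge. -/
theorem exists_quotient_lt_integrable (hN : 3 ≤ N) {α p S : ℝ} (hp : 0 ≤ p)
    {u : Sp N → ℝ} (hu : u ∈ RadialSpace N α p)
    (hq : dirichlet u < S * (∫ x, |u x| ^ critExp N) ^ (2 / critExp N)) :
    ∃ w ∈ RadialSpace N α p,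
      dirichlet w < S * (∫ x, |w x| ^ critExp N) ^ (2 / critExp N) ∧
      ∀ r, 0 < r → r ≤ critExp N → Integrable (fun x => |w x| ^ r) volume := by
  have hcr := critExp_pos hN
  have hcr2 : 0 < 2 / critExp N := by positivity
  have hi : Integrable (fun x => |u x| ^ critExp N) volume := by
    -- Otherwise the junk value `0` of the integral contradicts `0 ≤ dirichlet u`.
    by_contra h
    rw [integral_undef h, Real.zero_rpow hcr2.ne', mul_zero] at hq
    exact absurd (dirichlet_nonneg u) (not_le.2 hq)
  have hL : MemLp u (ENNReal.ofReal (critExp N)) volume :=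
    memLp_of_integrable_rpow hcr hu.1.1 hi
  obtain ⟨g, hg, hg2⟩ := hu.1.2.2
  obtain ⟨K, hK1, hK2⟩ := exists_between hq
  have hB : Filter.Tendsto
      (fun n : ℕ => S * (∫ x, |truncate u n x| ^ critExp N) ^ (2 / critExp N)) Filter.atTop
      (nhds (S * (∫ x, |u x| ^ critExp N) ^ (2 / critExp N))) :=
    ((tendsto_integral_truncate hu.1.1 hcr hi).rpow_const (Or.inr hcr2.le)).const_mul S
  obtain ⟨n, h1, h2⟩ := (((exists_weakGrad_truncate hN hg hg2 hL).2 K hK1).and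
    (hB.eventually_const_lt hK2)).exists
  exact ⟨truncate u n, truncate_mem_radialSpace hN hp hu hL n, h1.trans h2,
    fun r hr hrl => integrable_truncate_rpow hr hrl hL n⟩

/-! ### A nonzero element of the radial space -/

theorem cutoff_mem_radialSpace (hN : 1 ≤ N) {α p : ℝ} (hα0 : 0 < α) (hαN : α < N) (hp : 0 < p) :
    cutoff ∈ RadialSpace N α p := by
  refine ⟨⟨contDiff_cutoff.continuous.measurable.aemeasurable,
    coulomb_lt_top_of_bounded hN hα0 hαN hp Metric.isClosed_closedBall.measurableSet
    measure_closedBall_lt_top.ne (s := Metric.closedBall (0 : Sp N) 2) abs_cutoff_le_one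
    fun x hx => ?_, gradient cutoff, ?_, memLp_gradient_cutoff 2⟩, fun A =>
    Filter.Eventually.of_forall fun x => cutoff_map A x⟩
  · rw [Metric.mem_closedBall, dist_zero_right, not_le] at hx
    exact cutoff_eq_zero hx.le
  · simpa using hasWeakGrad_one.smooth_mul (contDiff_cutoff (N := N))

theorem integral_cutoff_rpow_pos {l : ℝ} (hl : 0 < l) :
    0 < ∫ x : Sp N, |cutoff x| ^ l := by
  have hcont : Continuous fun x : Sp N => |cutoff x| ^ l :=
    contDiff_cutoff.continuous.abs.rpow_const fun _ => Or.inr hl.le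
  refine hcont.integral_pos_of_hasCompactSupport_nonneg_nonzero ?_ (fun x => by positivity)
    (x := 0) ?_
  · refine hasCompactSupport_cutoff.comp_left (g := fun y : ℝ => |y| ^ l) ?_
    simp [hl.ne']
  · rw [cutoff_eq_one (by simp)]
    simp

/-! ### Exponents and the critical level -/

theorem sig_pos {α p : ℝ} (hα0 : 0 < α) (hp : 1 < p) : 0 < sig α p := by
  unfold sig
  have : 0 < p - 1 := by linarith
  positivity

theorem sExp_qExp {α p : ℝ} (hα0 : 0 < α) (hp : 1 < p) :
    sExp N α p (qExp α p) = 2 * sig α p + 2 - N := by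
  have : p - 1 ≠ 0 := by linarith
  have : 2 + α ≠ 0 := by linarith
  unfold sExp sig qExp
  field_simp
  ring

/-- The exponent `σ` is the one for which both terms of `I` scale by the same power. -/
theorem two_mul_sig_mul {α p : ℝ} (hp : 1 < p) :
    2 * p * sig α p - α = 2 * sig α p + 2 := by
  have : p - 1 ≠ 0 := by linarith
  unfold sig
  field_simp
  ring

theorem sExp_qExp_pos (hN : 3 ≤ N) {α p : ℝ} (hα0 : 0 < α) (hp : 1 < p)
    (hp2 : p < ((N : ℝ) + α) / ((N : ℝ) - 2)) : 0 < sExp N α p (qExp α p) := by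
  have hN3 : (3 : ℝ) ≤ N := by exact_mod_cast hN
  have h1 : 0 < p - 1 := by linarith
  rw [lt_div_iff₀ (by linarith)] at hp2
  rw [sExp_qExp hα0 hp]
  have : 2 * sig α p + 2 - N = (2 * p + α - N * (p - 1)) / (p - 1) := by
    unfold sig
    field_simp
    ring
  rw [this]
  exact div_pos (by nlinarith) h1

theorem sExp_critExp (hN : 3 ≤ N) {α p : ℝ} (hα0 : 0 < α) (hp : 1 < p) :
    sExp N α p (critExp N) = sExp N α p (qExp α p) * (critExp N / 2) := by
  have hN3 : (3 : ℝ) ≤ N := by exact_mod_cast hN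
  have : (N : ℝ) - 2 ≠ 0 := by linarith
  rw [sExp_qExp hα0 hp]
  unfold sExp critExp
  field_simp
  ring

theorem qExp_pos {α p : ℝ} (hα0 : 0 < α) (hp : 1 < p) : 0 < qExp α p := by
  unfold qExp
  have : 0 < p := by linarith
  positivity

theorem holderConjugate_critExp (hN : 3 ≤ N) :
    (critExp N / 2).HolderConjugate ((N : ℝ) / 2) := by
  have hN3 : (3 : ℝ) ≤ N := by exact_mod_cast hN
  have h2 : (0 : ℝ) < N - 2 := by linarith
  rw [Real.holderConjugate_iff]
  unfold critExp
  constructor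
  · rw [lt_div_iff₀ (by norm_num), lt_div_iff₀ h2]
    linarith
  · field_simp
    ring

/-- Since `s_{2*} = (2* / 2) s_q`, the critical level has the classical form `S ^ (N/2) / N`. -/
theorem cStar_eq (hN : 3 ≤ N) {α p : ℝ} (hα0 : 0 < α) (hp : 1 < p)
    (hp2 : p < ((N : ℝ) + α) / ((N : ℝ) - 2)) :
    cStar N α p = 1 / N * sobolevConst N α p ^ ((N : ℝ) / 2) := by
  have hN3 : (3 : ℝ) ≤ N := by exact_mod_cast hN
  have h2 : (0 : ℝ) < N - 2 := by linarith
  have hs := sExp_qExp_pos hN hα0 hp hp2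
  simp only [cStar]
  rw [sExp_critExp hN hα0 hp]
  set s := sExp N α p (qExp α p) with hsdef
  have e1 : critExp N / 2 * (s / (s * (critExp N / 2))) = 1 := by
    have := critExp_pos hN
    field_simp
  have hk : critExp N / 2 - 1 = 2 / (N - 2) := by
    unfold critExp
    field_simp
    ring
  have hd : s * (critExp N / 2) - s = s * (2 / (N - 2)) := by rw [← hk]; ring
  have e2 : s * (critExp N / 2) / (s * (critExp N / 2) - s) = N / 2 := by
    rw [hd]
    unfold critExp
    field_simp
  have e3 : (s * (critExp N / 2) - s) / (s * (critExp N / 2)) = 2 / N := by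
    rw [hd]
    unfold critExp
    field_simp
  rw [e1, e2, e3, Real.one_rpow]
  ring

/-! ### Scaling and the fibering map -/

theorem scale_eq (α p : ℝ) (u : Sp N → ℝ) (t : ℝ) :
    scale α p u t = fun x => t ^ sig α p * u (t • x) := rfl

theorem dirichlet_scale {α p : ℝ} (hα0 : 0 < α) (hp : 1 < p)
    {u : Sp N → ℝ} {g : Sp N → Sp N} (hg : HasWeakGrad u g) {t : ℝ} (ht : 0 < t) :
    dirichlet (scale α p u t) = t ^ sExp N α p (qExp α p) * dirichlet u := by
  rw [scale_eq, ((hg.comp_smul ht).const_mul _).dirichlet_eq, hg.dirichlet_eq]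
  simp only [norm_smul, mul_pow, integral_const_mul]
  rw [Measure.integral_comp_smul volume (fun x => ‖g x‖ ^ 2), smul_eq_mul, ← mul_assoc, ← mul_assoc]
  congr 1
  rw [sExp_qExp hα0 hp, Real.norm_of_nonneg (by positivity), Real.norm_of_nonneg ht.le,
    finrank_euclideanSpace_fin, abs_of_nonneg (by positivity), Real.rpow_sub ht, Real.rpow_natCast,
    Real.rpow_add ht, mul_comm 2, Real.rpow_mul ht.le, Real.rpow_ofNat, Real.rpow_ofNat,
    div_eq_mul_inv]

theorem coulomb_scale {α p : ℝ} (hα0 : 0 < α) (hp : 1 < p) (u : Sp N → ℝ) {t : ℝ} (ht : 0 < t) :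
    (coulomb N α p (scale α p u t)).toReal
      = t ^ sExp N α p (qExp α p) * (coulomb N α p u).toReal := by
  rw [scale_eq, coulomb_const_mul (by positivity) (fun x => u (t • x)), coulomb_comp_smul ht,
    ENNReal.toReal_mul, ENNReal.toReal_mul, ENNReal.toReal_ofReal (by positivity),
    ENNReal.toReal_ofReal (by positivity), ← mul_assoc, ← Real.rpow_mul ht.le, ← Real.rpow_add ht]
  congr 2
  rw [sExp_qExp hα0 hp, ← two_mul_sig_mul hp]
  ring

theorem integral_scale {α p l : ℝ} (u : Sp N → ℝ) {t : ℝ} (ht : 0 < t) :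
    ∫ x, |scale α p u t x| ^ l = t ^ sExp N α p l * ∫ x, |u x| ^ l := by
  have h : ∀ x : Sp N, |scale α p u t x| ^ l = t ^ (sig α p * l) * |u (t • x)| ^ l := by
    intro x
    rw [scale_eq, abs_mul, abs_of_pos (by positivity), Real.mul_rpow (by positivity)
      (abs_nonneg _), ← Real.rpow_mul ht.le]
  simp only [h]
  rw [integral_const_mul, Measure.integral_comp_smul volume (fun x => |u x| ^ l), smul_eq_mul,
    ← mul_assoc]
  congr 1
  rw [finrank_euclideanSpace_fin, abs_of_nonneg (by positivity), sExp, Real.rpow_sub ht,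
    Real.rpow_natCast, div_eq_mul_inv]

theorem fiber_eq {α p r c : ℝ} (hα0 : 0 < α) (hp : 1 < p)
    {u : Sp N → ℝ} {g : Sp N → Sp N} (hg : HasWeakGrad u g) {t : ℝ} (ht : 0 < t) :
    fiber N α p r c u t = (t ^ sExp N α p (qExp α p) * funI N α p u
      - t ^ sExp N α p (critExp N) * funG N u - c) / (t ^ sExp N α p r * funF r u) := by
  unfold fiber lam funI funG funF funPow
  rw [dirichlet_scale hα0 hp hg ht, coulomb_scale hα0 hp u ht, integral_scale u ht,
    integral_scale u ht]
  congr 1 <;> ring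

/-- The model fibering map `(t ^ a I - t ^ d G - c) / (t ^ b F)` has a critical point. -/
theorem exists_hasDerivAt_zero {a b d I G F c : ℝ} (ha : 0 < a) (hab : a ≤ b) (hbd : b < d)
    (hI : 0 ≤ I) (hG : 0 < G) (hF : 0 < F) (hc : 0 < c) :
    ∃ t : ℝ, 0 < t ∧
      HasDerivAt (fun t : ℝ => (t ^ a * I - t ^ d * G - c) / (t ^ b * F)) 0 t := by
  have hb : 0 < b := by linarith
  have hd : 0 < d := by linarith
  have hdb : 0 < d - b := by linarith
  -- Up to a positive factor, `h` is the derivative of the map.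
  set h : ℝ → ℝ := fun t => (a - b) * t ^ a * I - (d - b) * t ^ d * G + b * c with hh
  have hcont : Continuous h := by
    have c1 : Continuous fun t : ℝ => t ^ a := Real.continuous_rpow_const ha.le
    have c2 : Continuous fun t : ℝ => t ^ d := Real.continuous_rpow_const hd.le
    fun_prop
  have h0 : h 0 = b * c := by
    simp [hh, Real.zero_rpow ha.ne', Real.zero_rpow hd.ne']
  -- At `T` the term `-(d - b) T ^ d G` cancels `b c`, and the remaining term is nonpositive.
  set T : ℝ := (b * c / ((d - b) * G)) ^ d⁻¹ with hT
  have hT0 : 0 ≤ T := by positivity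
  have hTd : T ^ d = b * c / ((d - b) * G) := by
    rw [hT, ← Real.rpow_mul (by positivity), inv_mul_cancel₀ hd.ne', Real.rpow_one]
  have hhT : h T ≤ 0 := by
    have e1 : (d - b) * T ^ d * G = b * c := by
      rw [hTd]
      field_simp
    have e2 : (a - b) * T ^ a * I ≤ 0 := by
      have : 0 ≤ T ^ a * I := by positivity
      nlinarith
    simp only [hh]
    linarith
  obtain ⟨t, ⟨ht0, -⟩, ht⟩ := intermediate_value_Icc' hT0 hcont.continuousOn
    (show (0 : ℝ) ∈ Set.Icc (h T) (h 0) from ⟨hhT, by rw [h0]; positivity⟩)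
  have htpos : 0 < t := by
    refine lt_of_le_of_ne ht0 ?_
    rintro rfl
    rw [h0] at ht
    exact absurd ht (by positivity)
  refine ⟨t, htpos, ?_⟩
  have d1 : ∀ s : ℝ, HasDerivAt (fun t : ℝ => t ^ s) (s * t ^ (s - 1)) t := fun s =>
    Real.hasDerivAt_rpow_const (Or.inl htpos.ne')
  have d2 := ((((d1 a).mul_const I).sub ((d1 d).mul_const G)).sub_const c).fun_div
    ((d1 b).mul_const F) (by positivity)
  refine d2.congr_deriv ?_
  rw [div_eq_zero_iff]
  left
  rw [Real.rpow_sub_one htpos.ne', Real.rpow_sub_one htpos.ne', Real.rpow_sub_one htpos.ne']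
  have : (a - b) * t ^ a * I - (d - b) * t ^ d * G + b * c = 0 := ht
  have key : (a * (t ^ a / t) * I - d * (t ^ d / t) * G) * (t ^ b * F)
      - (t ^ a * I - t ^ d * G - c) * (b * (t ^ b / t) * F)
      = t ^ b / t * F * ((a - b) * t ^ a * I - (d - b) * t ^ d * G + b * c) := by ring
  simp only [Pi.sub_apply]
  rw [key, this, mul_zero]

/-! ### Near-optimal functions for the Sobolev quotient -/

/-- If `2 I ≤ S B ^ (2/2*)`, Young's inequality with exponents `2* / 2` and `N / 2` bounds
`τ I - τ ^ (2*/2) B / 2*`, the numerator of the fibering map in the variable `τ = t ^ s_q`. -/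
theorem mul_sub_rpow_mul_le (hN : 3 ≤ N) {τ I B S : ℝ} (hτ : 0 ≤ τ) (hB : 0 ≤ B) (hS : 0 ≤ S)
    (h : 2 * I ≤ S * B ^ (2 / critExp N)) :
    τ * I - τ ^ (critExp N / 2) * (1 / critExp N * B) ≤ 1 / N * S ^ ((N : ℝ) / 2) := by
  have hcr := critExp_pos hN
  have hconj := holderConjugate_critExp hN
  have hy := Real.young_inequality_of_nonneg (a := τ * B ^ (2 / critExp N)) (b := S)
    (by positivity) hS hconj
  rw [Real.mul_rpow hτ (by positivity), ← Real.rpow_mul hB,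
    show 2 / critExp N * (critExp N / 2) = 1 by field_simp, Real.rpow_one] at hy
  have h1 : τ * (2 * I) ≤ τ * (S * B ^ (2 / critExp N)) := mul_le_mul_of_nonneg_left h hτ
  have e1 : τ ^ (critExp N / 2) * B / (critExp N / 2)
      = 2 * (τ ^ (critExp N / 2) * (1 / critExp N * B)) := by field_simp
  have hN0 : (N : ℝ) ≠ 0 := by
    have : N ≠ 0 := by omega
    exact_mod_cast this
  have e2 : S ^ ((N : ℝ) / 2) / (N / 2) = 2 * (1 / N * S ^ ((N : ℝ) / 2)) := by field_simp
  rw [e1, e2] at hy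
  linarith

theorem const_mul_mem_radialSpace {α p a : ℝ} (ha : 0 < a) {u : Sp N → ℝ}
    (hu : u ∈ RadialSpace N α p) : (fun x => a * u x) ∈ RadialSpace N α p := by
  obtain ⟨⟨hm, hc, g, hg, hg2⟩, hr⟩ := hu
  refine ⟨⟨hm.const_mul a, ?_, _, hg.const_mul a, hg2.const_smul a⟩, fun A => ?_⟩
  · rw [coulomb_const_mul ha]
    exact ENNReal.mul_lt_top ENNReal.ofReal_lt_top hc
  · filter_upwards [hr A] with x hx
    rw [hx]

/-- Multiplication by a small constant makes the Coulomb energy, of degree `2 p > 2`, negligible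
against the Dirichlet energy, so that `I` inherits a strict bound on the Sobolev quotient. -/
theorem exists_funI_le (hN : 3 ≤ N) {α p S : ℝ} (hp : 1 < p)
    {u : Sp N → ℝ} (hu : u ∈ RadialSpace N α p)
    (hq : dirichlet u < S * (∫ x, |u x| ^ critExp N) ^ (2 / critExp N)) :
    ∃ a : ℝ, 0 < a ∧ 2 * funI N α p (fun x => a * u x)
      ≤ S * (∫ x, |a * u x| ^ critExp N) ^ (2 / critExp N) := by
  have hcr := critExp_pos hN
  set B := ∫ x, |u x| ^ critExp N with hB
  have hB0 : 0 ≤ B := integral_nonneg fun _ => by positivity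
  set C := (coulomb N α p u).toReal with hC
  obtain ⟨g, hg, -⟩ := hu.1.2.2
  have hlim : Filter.Tendsto (fun a : ℝ => dirichlet u + a ^ (2 * p - 2) * (1 / p * C))
      (nhdsWithin 0 (Set.Ioi 0)) (nhds (dirichlet u + 0 ^ (2 * p - 2) * (1 / p * C))) := by
    have h1 : Continuous fun a : ℝ => a ^ (2 * p - 2) :=
      Real.continuous_rpow_const (by linarith)
    have h2 : Continuous fun a : ℝ => dirichlet u + a ^ (2 * p - 2) * (1 / p * C) := by fun_prop
    exact (h2.tendsto 0).mono_left nhdsWithin_le_nhds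
  rw [Real.zero_rpow (by linarith), zero_mul, add_zero] at hlim
  obtain ⟨a, ha, ha0⟩ := ((hlim.eventually_lt_const hq).and self_mem_nhdsWithin).exists
  have ha0 : 0 < a := ha0
  refine ⟨a, ha0, ?_⟩
  have e1 : ∫ x, |a * u x| ^ critExp N = a ^ critExp N * B := by
    rw [hB, ← integral_const_mul]
    congr 1
    ext x
    rw [abs_mul, abs_of_pos ha0, Real.mul_rpow ha0.le (abs_nonneg _)]
  have e2 : dirichlet (fun x => a * u x) = a ^ 2 * dirichlet u := by
    rw [(hg.const_mul a).dirichlet_eq, hg.dirichlet_eq, ← integral_const_mul]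
    congr 1
    ext x
    rw [norm_smul, mul_pow, Real.norm_of_nonneg ha0.le]
  have e3 : (a ^ critExp N * B) ^ (2 / critExp N) = a ^ 2 * B ^ (2 / critExp N) := by
    rw [Real.mul_rpow (by positivity) hB0, ← Real.rpow_mul ha0.le,
      show critExp N * (2 / critExp N) = 2 by field_simp, Real.rpow_ofNat]
  have e4 : a ^ (2 * p) = a ^ 2 * a ^ (2 * p - 2) := by
    rw [← Real.rpow_ofNat, ← Real.rpow_add ha0]
    congr 1
    ring
  rw [e1, e3]
  unfold funI
  rw [e2, coulomb_const_mul ha0, ENNReal.toReal_mul, ENNReal.toReal_ofReal (by positivity), e4]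
  calc 2 * (1 / 2 * (a ^ 2 * dirichlet u) + 1 / (2 * p) * (a ^ 2 * a ^ (2 * p - 2) * C))
      = a ^ 2 * (dirichlet u + a ^ (2 * p - 2) * (1 / p * C)) := by
        have : p ≠ 0 := by linarith
        field_simp
    _ ≤ a ^ 2 * (S * B ^ (2 / critExp N)) := by gcongr
    _ = _ := by ring

/-- Testing with the cutoff bounds the admissible Sobolev constants, so that the supremum defining
`sobolevConst` is not a junk value. -/
theorem bddAbove_sobolev (hN : 3 ≤ N) {α p : ℝ} (hα0 : 0 < α) (hαN : α < N) (hp : 0 < p) :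
    BddAbove {S : ℝ | ∀ u ∈ RadialSpace N α p,
      S * (∫ x, |u x| ^ critExp N) ^ (2 / critExp N) ≤ dirichlet u} := by
  refine ⟨dirichlet (cutoff (N := N)) /
    (∫ x : Sp N, |cutoff x| ^ critExp N) ^ (2 / critExp N), fun S hS => ?_⟩
  rw [le_div_iff₀ (Real.rpow_pos_of_pos (integral_cutoff_rpow_pos (critExp_pos hN)) _)]
  exact hS _ (cutoff_mem_radialSpace (by omega) hα0 hαN hp)

theorem sobolevConst_nonneg (hN : 3 ≤ N) {α p : ℝ} (hα0 : 0 < α) (hαN : α < N) (hp : 0 < p) :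
    0 ≤ sobolevConst N α p := by
  refine le_csSup (bddAbove_sobolev hN hα0 hαN hp) fun u _ => ?_
  rw [zero_mul]
  exact dirichlet_nonneg u

theorem exists_quotient_lt (hN : 3 ≤ N) {α p S : ℝ} (hα0 : 0 < α) (hαN : α < N) (hp : 0 < p)
    (hS : sobolevConst N α p < S) :
    ∃ u ∈ RadialSpace N α p,
      dirichlet u < S * (∫ x, |u x| ^ critExp N) ^ (2 / critExp N) := by
  by_contra! h
  exact absurd (le_csSup (bddAbove_sobolev hN hα0 hαN hp) h) (not_le.2 hS)

/-! ### A negative value of `λ_c` on the Nehari manifold -/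

/-- Above the critical level, the scaled Nehari manifold contains a point where `λ_c` is
negative. -/
theorem exists_mem_nehari_lam_neg (hN : 3 ≤ N) {α p r c : ℝ} (hα0 : 0 < α) (hαN : α < N)
    (hp1 : 1 < p) (hp2 : p < ((N : ℝ) + α) / ((N : ℝ) - 2)) (hr1 : qExp α p ≤ r)
    (hr2 : r < critExp N) (hc : cStar N α p < c) :
    ∃ w ∈ nehari N α p r c, lam N α p r c w < 0 := by
  have hp0 : 0 < p := by linarith
  have hN0 : (0 : ℝ) < N := by
    have : 0 < N := by omega
    exact_mod_cast this
  have hcr := critExp_pos hN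
  have hr0 : 0 < r := (qExp_pos hα0 hp1).trans_le hr1
  rw [cStar_eq hN hα0 hp1 hp2] at hc
  have hS0 := sobolevConst_nonneg hN hα0 hαN hp0
  have hc0 : 0 < c := lt_of_le_of_lt (by positivity) hc
  -- `S` exceeds the Sobolev constant so little that its level `S ^ (N/2) / N` is still below `c`.
  obtain ⟨S, hSc, hS⟩ : ∃ S, 1 / (N : ℝ) * S ^ ((N : ℝ) / 2) < c ∧ sobolevConst N α p < S := by
    have h1 : Continuous fun S : ℝ => 1 / (N : ℝ) * S ^ ((N : ℝ) / 2) :=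
      continuous_const.mul (Real.continuous_rpow_const (by positivity))
    exact ((((h1.tendsto (sobolevConst N α p)).eventually_lt_const hc).filter_mono
      nhdsWithin_le_nhds).and (self_mem_nhdsWithin (s := Set.Ioi _))).exists
  have hSnn : 0 ≤ S := hS0.trans hS.le
  obtain ⟨u, hu, hq⟩ := exists_quotient_lt hN hα0 hαN hp0 hS
  obtain ⟨w, hw, hwq, hwi⟩ := exists_quotient_lt_integrable hN hp0.le hu hq
  obtain ⟨a, ha, hI⟩ := exists_funI_le hN hp1 hw hwq
  set v : Sp N → ℝ := fun x => a * w x with hv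
  have hvR : v ∈ RadialSpace N α p := const_mul_mem_radialSpace ha hw
  have hwnz : ¬ w =ᵐ[volume] 0 := by
    intro h0
    have : ∫ x, |w x| ^ critExp N = 0 := by
      refine integral_eq_zero_of_ae ?_
      filter_upwards [h0] with x hx
      simp [hx, hcr.ne']
    rw [this, Real.zero_rpow (by positivity), mul_zero] at hwq
    exact absurd (dirichlet_nonneg w) (not_le.2 hwq)
  have hvnz : ¬ v =ᵐ[volume] 0 := by
    refine fun h0 => hwnz ?_
    filter_upwards [h0] with x hx
    simpa [hv, ha.ne'] using hx
  have hpos : ∀ l, 0 < l → l ≤ critExp N → 0 < ∫ x, |v x| ^ l := by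
    intro l hl hl2
    have hi : Integrable (fun x => |v x| ^ l) volume := by
      refine ((hwi l hl hl2).const_mul (a ^ l)).congr (Filter.Eventually.of_forall fun x => ?_)
      simp only [hv]
      rw [abs_mul, abs_of_pos ha, Real.mul_rpow ha.le (abs_nonneg _)]
    refine lt_of_le_of_ne (integral_nonneg fun _ => by positivity) fun h0 => hvnz ?_
    have := (integral_eq_zero_iff_of_nonneg (fun x => by positivity) hi).1 h0.symm
    filter_upwards [this] with x hx
    have hx' : |v x| ^ l = 0 := hx
    rw [Real.rpow_eq_zero (abs_nonneg _) hl.ne'] at hx'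
    simpa using hx'
  obtain ⟨g, hg, -⟩ := hvR.1.2.2
  have hF : 0 < funF r v := mul_pos (by positivity) (hpos r hr0 hr2.le)
  have hG : 0 < funG N v := mul_pos (by positivity) (hpos _ hcr le_rfl)
  have hInn : 0 ≤ funI N α p v := by
    have := dirichlet_nonneg v
    unfold funI
    positivity
  have hσ := sig_pos hα0 hp1
  have hsq := sExp_qExp_pos hN hα0 hp1 hp2
  obtain ⟨t, ht, hder⟩ := exists_hasDerivAt_zero (a := sExp N α p (qExp α p))
    (b := sExp N α p r) (d := sExp N α p (critExp N)) hsq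
    (by unfold sExp; gcongr) (by unfold sExp; gcongr) hInn hG hF hc0
  have hfib : HasDerivAt (fiber N α p r c v) 0 t := by
    refine hder.congr_of_eventuallyEq ?_
    filter_upwards [lt_mem_nhds ht] with s hs
    exact fiber_eq hα0 hp1 hg hs
  refine ⟨scale α p v t, ⟨v, ⟨hvR, hvnz⟩, t, ht, hfib, rfl⟩, ?_⟩
  change fiber N α p r c v t < 0
  rw [fiber_eq hα0 hp1 hg ht]
  refine div_neg_of_neg_of_pos ?_ (by positivity)
  have := mul_sub_rpow_mul_le hN (τ := t ^ sExp N α p (qExp α p)) (by positivity)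
    (hpos _ hcr le_rfl).le hSnn hI
  rw [← Real.rpow_mul ht.le, ← sExp_critExp hN hα0 hp1] at this
  unfold funG funPow
  linarith

end SPS

theorem proposition2p13 (N : ℕ) (hN : 3 ≤ N) (α p r c : ℝ)
    (hα0 : 0 < α) (hαN : α < (N : ℝ))
    (hp1 : 1 < p) (hp2 : p < ((N : ℝ) + α) / ((N : ℝ) - 2))
    (hr1 : SPS.qExp α p ≤ r) (hr2 : r < SPS.critExp N)
    (hc : SPS.cStar N α p < c) :
    SPS.infLam N α p r c < 0 ∧
      ∀ u ∈ SPS.nehari N α p r c, 0 < SPS.lam N α p r c u →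
        ((SPS.lam N α p r c u : ℝ) : EReal) ≠ SPS.infLam N α p r c := by
  obtain ⟨w, hw, hneg⟩ := SPS.exists_mem_nehari_lam_neg hN hα0 hαN hp1 hp2 hr1 hr2 hc
  have hinf : SPS.infLam N α p r c < 0 :=
    (iInf₂_le w hw).trans_lt (by exact_mod_cast hneg)
  refine ⟨hinf, fun u _ hpos heq => ?_⟩
  rw [← heq] at hinf
  exact absurd hpos (not_lt.2 (by exact_mod_cast hinf.le))
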